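/- A permutation $\tau$ of $[n]=\{1,\dots,n\}$ (written as a sequence) contains a pattern $\pi$, a permutation of $[k]$, if $\tau$ has a (not necessarily contiguous) subsequence $\sigma$ of length $k$ with $\sigma(i)<\sigma(j)\iff\pi(i)<\pi(j)$ for all $i,j\in[k]$. In the streaming problem $\pi$-$\mathrm{PPM}_n$, a permutation $\tau$ of $[n]$ is given one value at a time, and it must be decided whether $\tau$ contains $\pi$. A (deterministic, one-pass) streaming algorithm for this problem is a finite state machine with state set $Q$, an initial state, a set $F\subseteq Q$ of accepting states and an arbitrary transition function $Q\times[n]\to Q$, which may depend on $n$. It is correct if for every permutation $\tau$ of $[n]$ the state reached after reading $\tau$ lies in $F$ if and only if $\tau$ contains $\pi$. Its space usage is $\lceil\log_2|Q|\rceil$ bits, and the space complexity of the problem is the minimum space usage of a correct streaming algorithm. Theorem. As $n\to\infty$, the space complexity of $\pi$-$\mathrm{PPM}_n$ is \begin{itemize} \item $\mathcal{O}(\sqrt{n\log n})$ bits if $\pi\in\{312,132\}$, and \item $\mathcal{O}(\sqrt{n}\,\log n)$ bits if $\pi\in\{231,213\}$. \end{itemize} -/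

import Mathlib

namespace StreamPPM

/-- Two finite sequences are order-isomorphic: they have the same length `k` and
`π(i) < π(j) ↔ σ(i) < σ(j)` for all positions `i, j`. -/
def OrderIsomorphic {α β : Type} [LT α] [LT β] (π : List α) (σ : List β) : Prop :=
  ∃ h : π.length = σ.length, ∀ i j : Fin π.length,
    π.get i < π.get j ↔ σ.get (i.cast h) < σ.get (j.cast h)

/-- The sequence `τ` contains the pattern `π`: some (not necessarily contiguous) subsequence of
`τ` is order-isomorphic to `π`. -/
def Contains {α β : Type} [LT α] [LT β] (τ : List β) (π : List α) : Prop :=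
  ∃ σ : List β, σ.Sublist τ ∧ OrderIsomorphic π σ

/-- A streaming problem over an alphabet: a finite set of possible input streams and the set of
YES-instances among them. -/
structure StreamingProblem (Alphabet : Type) where
  domain : Set (List Alphabet)
  finite_domain : domain.Finite
  yes : Set (List Alphabet)
  yes_subset : yes ⊆ domain

/-- A streaming algorithm: a state machine with finitely many states, an initial state, a set of
accepting states and an arbitrary transition function. -/
structure StreamingAlgorithm (Alphabet : Type) where
  State : Type
  finite_state : Finite State
  init : State
  accept : Set State
  step : State → Alphabet → State

namespace StreamingAlgorithm

variable {Alphabet : Type}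

/-- The state after reading the whole stream, starting in the initial state. -/
def run (A : StreamingAlgorithm Alphabet) (τ : List Alphabet) : A.State :=
  τ.foldl A.step A.init

/-- Correctness: on each possible input stream, the final state is accepting if and only if the
stream is a YES-instance. Nothing is required outside the domain. -/
def Correct (A : StreamingAlgorithm Alphabet) (P : StreamingProblem Alphabet) : Prop :=
  ∀ τ ∈ P.domain, A.run τ ∈ A.accept ↔ τ ∈ P.yes

/-- The space usage in bits, `⌈log₂ |Q|⌉` where `Q` is the set of states. -/
noncomputable def space (A : StreamingAlgorithm Alphabet) : ℕ :=
  Nat.clog 2 (Nat.card A.State)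

end StreamingAlgorithm

/-- The space complexity of a streaming problem: the least space usage of a correct streaming
algorithm. The set is never empty, see `exists_correct`. -/
noncomputable def spaceComplexity {Alphabet : Type} (P : StreamingProblem Alphabet) : ℕ :=
  sInf {s | ∃ A : StreamingAlgorithm Alphabet, A.Correct P ∧ A.space = s}

/-- Every streaming problem has a correct algorithm, which stores the prefix read so far. -/
theorem exists_correct {Alphabet : Type} (P : StreamingProblem Alphabet) :
    ∃ A : StreamingAlgorithm Alphabet, A.Correct P := by
  classical
  let pre : Set (List Alphabet) := {l | ∃ d ∈ P.domain, l <+: d}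
  have hpre : pre.Finite := by
    have h : pre = ⋃ d ∈ P.domain, {l | l ∈ d.inits} := by
      ext l; simp [pre, List.mem_inits]
    rw [h]
    exact P.finite_domain.biUnion fun d _ => List.finite_toSet d.inits
  have hfin : Finite pre := hpre
  let A : StreamingAlgorithm Alphabet :=
    { State := Option pre
      finite_state := inferInstance
      init := if h : [] ∈ pre then some ⟨[], h⟩ else none
      accept := {q | ∃ l : pre, q = some l ∧ l.1 ∈ P.yes}
      step := fun q a => match q with
        | some l => if h : l.1 ++ [a] ∈ pre then some ⟨l.1 ++ [a], h⟩ else none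
        | none => none }
  have key : ∀ l : List Alphabet, ∀ h : l ∈ pre, A.run l = some ⟨l, h⟩ := by
    intro l
    induction l using List.reverseRecOn with
    | nil => intro h; simp [StreamingAlgorithm.run, A, h]
    | append_singleton l a ih =>
      intro h
      have hl : l ∈ pre := by
        obtain ⟨d, hd, hp⟩ := h
        exact ⟨d, hd, (List.prefix_append l [a]).trans hp⟩
      have h1 := ih hl
      simp only [StreamingAlgorithm.run, List.foldl_append, List.foldl_cons, List.foldl_nil]
        at h1 ⊢
      rw [h1]
      simp [A, h]
  refine ⟨A, fun τ hτ => ?_⟩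
  have hp : τ ∈ pre := ⟨τ, hτ, List.prefix_rfl⟩
  rw [key τ hp]
  constructor
  · rintro ⟨l, hl, hy⟩
    simp only [Option.some.injEq] at hl
    rw [← hl] at hy
    exact hy
  · intro hy
    exact ⟨⟨τ, hp⟩, rfl, hy⟩

/-- The space complexity is attained by a correct algorithm. -/
theorem exists_correct_space_eq {Alphabet : Type} (P : StreamingProblem Alphabet) :
    ∃ A : StreamingAlgorithm Alphabet, A.Correct P ∧ A.space = spaceComplexity P := by
  obtain ⟨A, hA⟩ := exists_correct P
  exact Nat.sInf_mem
    (s := {s | ∃ A : StreamingAlgorithm Alphabet, A.Correct P ∧ A.space = s}) ⟨_, A, hA, rfl⟩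

/-- The sequences in which each of the `n` values occurs exactly once, i.e. the permutations of
the `n`-element linear order `Fin n`. -/
def permutations (n : ℕ) : Set (List (Fin n)) :=
  {τ | ∀ a : Fin n, τ.count a = 1}

theorem finite_permutations (n : ℕ) : (permutations n).Finite := by
  have h : {l : List (Fin n) | l.Nodup}.Finite :=
    (inferInstance : Finite {l : List (Fin n) // l.Nodup})
  exact h.subset fun τ hτ => List.nodup_iff_count_le_one.mpr fun a => (hτ a).le

/-- Pattern matching in permutation streams of length `n`: does the permutation `τ` contain `π`? -/
def PPM (π : List ℕ) (n : ℕ) : StreamingProblem (Fin n) where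
  domain := permutations n
  finite_domain := finite_permutations n
  yes := {τ ∈ permutations n | Contains τ π}
  yes_subset := fun _ h => h.1

end StreamPPM

/-! Cut the values into blocks of `B` consecutive values. An algorithm keeps little data per block
and detailed data for one distinguished block; the type of summaries of prefixes then bounds the
number of states. Complementing values turns 132 into 312 and 231 into 213, so two patterns suffice.

For 312 (z, x, y with x < y < z) the distinguished block is that of the maximum seen, where the seen
set is stored in `B` bits. On arrival of x one looks for an unseen y below the maximum. If y lies in
a block strictly between those of x and the maximum, the number of seen values per block decides
this, because any unseen value there will do; in the top block the stored set decides it. If x and y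
share a lower block, then x is late, that is, preceded by a value of a higher block, and the
occurrence is caught when y arrives, by comparison with the minimum late value of the block. This
costs O((n/B) log n + B) bits, balanced at B about √(n log n).

For 213 (y, x, z with x < y < z) the distinguished block is the highest one with an unseen value,
called open. If x arrives below the open block, one needs a seen y and an unseen z with x < y < z;
counts, minima and maxima of the seen values per block decide this. If x arrives in the open block,
then x, y and z all lie there and all higher blocks are complete. So x and z enter the stored list
of arrivals in the open block since that time. Once the block is complete, y has been seen, and y
precedes x unless the list shows it after x. The list has at most `B` entries of O(log n) bits, so B
about √n is optimal for this scheme. -/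

namespace StreamPPM

/-! ### Algorithms from deterministically updated summaries -/

/-- A bound on the space complexity from a summary `φ` of prefixes: the summary is updated
deterministically, and the YES-instances are those with a violation that is visible from the
summary of some prefix and the next letter. -/
theorem spaceComplexity_le_of_summary {α Q : Type} [Finite Q] (P : StreamingProblem α)
    (good : List α → Prop) (φ : List α → Q) (V : List α → α → Prop)
    (hgood : ∀ τ ∈ P.domain, ∀ l, l <+: τ → good l)
    (hφ : ∀ l l' a, good (l ++ [a]) → good (l' ++ [a]) → φ l = φ l' →
      φ (l ++ [a]) = φ (l' ++ [a]))
    (hV : ∀ l l' a, good (l ++ [a]) → good (l' ++ [a]) → φ l = φ l' → V l a → V l' a)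
    (hyes : ∀ τ ∈ P.domain, τ ∈ P.yes ↔ ∃ l a r, τ = l ++ a :: r ∧ V l a) :
    spaceComplexity P ≤ Nat.clog 2 (Nat.card Q * 2) := by
  classical
  let A : StreamingAlgorithm α :=
    { State := Q × Bool
      finite_state := inferInstance
      init := (φ [], false)
      accept := {q | q.2 = true}
      -- The machine does not know the true prefix. It picks any prefix with the stored summary that
      -- the next letter extends to a good one; by `hφ` and `hV` the choice is immaterial. The
      -- Boolean remembers whether a violation has occurred.
      step := fun q a => if h : ∃ l, good (l ++ [a]) ∧ φ l = q.1 then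
        (φ (h.choose ++ [a]), q.2 || decide (V h.choose a)) else q }
  have key : ∀ l : List α, (∀ p, p <+: l → good p) →
      (A.run l).1 = φ l ∧ ((A.run l).2 = true ↔ ∃ p a r, l = p ++ a :: r ∧ V p a) := by
    intro l
    induction l using List.reverseRecOn with
    | nil => intro _; simp [StreamingAlgorithm.run, A]
    | append_singleton l a ih =>
      intro hl
      obtain ⟨h1, h2⟩ := ih fun p hp => hl p (hp.trans (List.prefix_append _ _))
      have hla : good (l ++ [a]) := hl _ List.prefix_rfl
      have hex : ∃ l', good (l' ++ [a]) ∧ φ l' = (A.run l).1 := ⟨l, hla, h1.symm⟩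
      have hrun : A.run (l ++ [a]) =
          (φ (hex.choose ++ [a]), (A.run l).2 || decide (V hex.choose a)) := by
        have : A.run (l ++ [a]) = A.step (A.run l) a := by
          simp [StreamingAlgorithm.run, List.foldl_append]
        rw [this]
        exact dif_pos hex
      obtain ⟨hg, he⟩ := hex.choose_spec
      replace he := he.trans h1
      rw [hrun]
      refine ⟨hφ _ _ _ hg hla he, ?_⟩
      have hVV : V hex.choose a ↔ V l a := ⟨hV _ _ _ hg hla he, hV _ _ _ hla hg he.symm⟩
      simp only [Bool.or_eq_true, decide_eq_true_eq, h2, hVV]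
      constructor
      · rintro (⟨p, b, r, rfl, hv⟩ | hv)
        · exact ⟨p, b, r ++ [a], by simp, hv⟩
        · exact ⟨l, a, [], rfl, hv⟩
      · rintro ⟨p, b, r, hr, hv⟩
        rcases List.eq_nil_or_concat r with rfl | ⟨r', c, rfl⟩
        · obtain ⟨rfl, hab⟩ := List.append_inj' hr rfl
          obtain rfl : a = b := by simpa using hab
          exact Or.inr hv
        · have : l ++ [a] = (p ++ b :: r') ++ [c] := by simpa using hr
          exact Or.inl ⟨p, b, r', (List.append_inj' this rfl).1, hv⟩
  have hA : A.Correct P := by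
    intro τ hτ
    rw [hyes τ hτ]
    exact (key τ (hgood τ hτ)).2
  refine Nat.sInf_le ⟨A, hA, ?_⟩
  simp [StreamingAlgorithm.space, A, Nat.card_prod]

/-! ### The four patterns as triples, and complementation of values -/

theorem orderIsomorphic_triple {α β : Type} [Preorder α] [Preorder β] (p q r : α) (x y z : β) :
    OrderIsomorphic [p, q, r] [x, y, z] ↔
      (p < q ↔ x < y) ∧ (p < r ↔ x < z) ∧ (q < p ↔ y < x) ∧ (q < r ↔ y < z) ∧
        (r < p ↔ z < x) ∧ (r < q ↔ z < y) := by
  constructor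
  · rintro ⟨_, h⟩
    exact ⟨h 0 1, h 0 2, h 1 0, h 1 2, h 2 0, h 2 1⟩
  · rintro ⟨h1, h2, h3, h4, h5, h6⟩
    refine ⟨rfl, fun i j => ?_⟩
    change Fin 3 at i j
    fin_cases i <;> fin_cases j <;> first | assumption | simp

theorem contains_triple {α β : Type} [Preorder α] [Preorder β] (τ : List β) (p q r : α) :
    Contains τ [p, q, r] ↔
      ∃ x y z, [x, y, z].Sublist τ ∧ OrderIsomorphic [p, q, r] [x, y, z] := by
  constructor
  · rintro ⟨σ, hσ, h⟩
    obtain ⟨x, y, z, rfl⟩ := List.length_eq_three.mp h.1.symm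
    exact ⟨x, y, z, hσ, h⟩
  · rintro ⟨x, y, z, h⟩
    exact ⟨_, h⟩

section

variable {β : Type} [LinearOrder β] (τ : List β)

theorem contains_312 :
    Contains τ [3, 1, 2] ↔ ∃ z x y, [z, x, y].Sublist τ ∧ x < y ∧ y < z := by
  simp only [contains_triple, orderIsomorphic_triple]
  refine exists_congr fun z => exists_congr fun x => exists_congr fun y => and_congr_right fun _ => ?_
  norm_num
  grind

theorem contains_132 :
    Contains τ [1, 3, 2] ↔ ∃ x z y, [x, z, y].Sublist τ ∧ x < y ∧ y < z := by
  simp only [contains_triple, orderIsomorphic_triple]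
  refine exists_congr fun z => exists_congr fun x => exists_congr fun y => and_congr_right fun _ => ?_
  norm_num
  grind

theorem contains_213 :
    Contains τ [2, 1, 3] ↔ ∃ y x z, [y, x, z].Sublist τ ∧ x < y ∧ y < z := by
  simp only [contains_triple, orderIsomorphic_triple]
  refine exists_congr fun z => exists_congr fun x => exists_congr fun y => and_congr_right fun _ => ?_
  norm_num
  grind

theorem contains_231 :
    Contains τ [2, 3, 1] ↔ ∃ y z x, [y, z, x].Sublist τ ∧ x < y ∧ y < z := by
  simp only [contains_triple, orderIsomorphic_triple]
  refine exists_congr fun z => exists_congr fun x => exists_congr fun y => and_congr_right fun _ => ?_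
  norm_num
  grind

end

theorem exists_sublist_map_rev {n : ℕ} (τ : List (Fin n)) (p : Fin n → Fin n → Fin n → Prop) :
    (∃ x y z, [x, y, z].Sublist (τ.map Fin.rev) ∧ p x y z) ↔
      ∃ x y z, [x, y, z].Sublist τ ∧ p x.rev y.rev z.rev := by
  constructor
  · rintro ⟨x, y, z, h, hp⟩
    refine ⟨x.rev, y.rev, z.rev, ?_, by simpa using hp⟩
    simpa [List.map_map, Fin.rev_involutive.comp_self] using h.map Fin.rev
  · rintro ⟨x, y, z, h, hp⟩
    exact ⟨x.rev, y.rev, z.rev, h.map Fin.rev, hp⟩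

theorem contains_312_map_rev {n : ℕ} (τ : List (Fin n)) :
    Contains (τ.map Fin.rev) [3, 1, 2] ↔ Contains τ [1, 3, 2] := by
  rw [contains_312, contains_132, exists_sublist_map_rev τ fun z x y => x < y ∧ y < z]
  simp only [Fin.rev_lt_rev]
  exact exists_congr fun _ => exists_congr fun _ => exists_congr fun _ =>
    and_congr_right fun _ => and_comm

theorem contains_213_map_rev {n : ℕ} (τ : List (Fin n)) :
    Contains (τ.map Fin.rev) [2, 1, 3] ↔ Contains τ [2, 3, 1] := by
  rw [contains_213, contains_231, exists_sublist_map_rev τ fun y x z => x < y ∧ y < z]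
  simp only [Fin.rev_lt_rev]
  exact exists_congr fun _ => exists_congr fun _ => exists_congr fun _ =>
    and_congr_right fun _ => and_comm

/-- Complementing the values transfers algorithms between a pattern and its complement. -/
theorem spaceComplexity_le_of_map_rev {n : ℕ} {π π' : List ℕ}
    (h : ∀ τ : List (Fin n), Contains (τ.map Fin.rev) π ↔ Contains τ π') :
    spaceComplexity (PPM π' n) ≤ spaceComplexity (PPM π n) := by
  obtain ⟨A, hA, hs⟩ := exists_correct_space_eq (PPM π n)
  let A' : StreamingAlgorithm (Fin n) :=
    { State := A.State
      finite_state := A.finite_state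
      init := A.init
      accept := A.accept
      step := fun q a => A.step q a.rev }
  refine Nat.sInf_le ⟨A', fun τ hτ => ?_, hs⟩
  have hτ' : τ.map Fin.rev ∈ permutations n := by
    intro a
    have := List.count_map_of_injective τ Fin.rev Fin.rev_injective a.rev
    rw [Fin.rev_rev] at this
    rw [this]
    exact hτ _
  have hrun : A'.run τ = A.run (τ.map Fin.rev) := by
    simp [StreamingAlgorithm.run, A', List.foldl_map]
  have := hA _ hτ'
  rw [hrun]
  refine this.trans ?_
  exact ⟨fun hy => ⟨hτ, (h τ).1 hy.2⟩, fun hy => ⟨hτ', (h τ).2 hy.2⟩⟩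

/-! ### Order of arrival expressed by sublists -/

section Sublists

variable {α : Type}

theorem pair_sublist_iff {x y : α} {l : List α} :
    [x, y].Sublist l ↔ ∃ p s, l = p ++ y :: s ∧ x ∈ p := by
  constructor
  · intro h
    obtain ⟨r₁, r₂, rfl, hx, hy⟩ := List.cons_sublist_iff.mp h
    obtain ⟨s, t, rfl⟩ := List.append_of_mem (List.singleton_sublist.mp hy)
    exact ⟨r₁ ++ s, t, by simp, by simp [hx]⟩
  · rintro ⟨p, s, rfl, hx⟩
    exact (List.singleton_sublist.mpr hx).append (by simp : [y].Sublist (y :: s))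

theorem triple_sublist_iff {x y z : α} {l : List α} :
    [x, y, z].Sublist l ↔ ∃ p s, l = p ++ y :: s ∧ x ∈ p ∧ z ∈ s := by
  constructor
  · intro h
    obtain ⟨r₁, r₂, rfl, hx, h2⟩ := List.cons_sublist_iff.mp h
    obtain ⟨r₃, r₄, rfl, hy, hz⟩ := List.cons_sublist_iff.mp h2
    obtain ⟨s, t, rfl⟩ := List.append_of_mem hy
    exact ⟨r₁ ++ s, t ++ r₄, by simp, by simp [hx], by simp [List.singleton_sublist.mp hz]⟩
  · rintro ⟨p, s, rfl, hx, hz⟩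
    exact (List.singleton_sublist.mpr hx).append
      ((List.singleton_sublist.mpr hz).cons_cons y)

theorem pair_sublist_concat {x y a : α} {l : List α} :
    [x, y].Sublist (l ++ [a]) ↔ [x, y].Sublist l ∨ (y = a ∧ x ∈ l) := by
  constructor
  · intro h
    obtain ⟨p, s, hl, hx⟩ := pair_sublist_iff.mp h
    rcases List.eq_nil_or_concat s with rfl | ⟨s', c, rfl⟩
    · obtain ⟨rfl, hab⟩ := List.append_inj' hl rfl
      exact Or.inr ⟨by simpa using hab.symm, hx⟩
    · have : l ++ [a] = (p ++ y :: s') ++ [c] := by simpa using hl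
      exact Or.inl (pair_sublist_iff.mpr ⟨p, s', (List.append_inj' this rfl).1, hx⟩)
  · rintro (h | ⟨rfl, h⟩)
    · exact h.trans (List.sublist_append_left _ _)
    · exact pair_sublist_iff.mpr ⟨l, [], rfl, h⟩

theorem pair_sublist_or {x y : α} {l : List α} (hx : x ∈ l) (hy : y ∈ l) (hxy : x ≠ y) :
    [x, y].Sublist l ∨ [y, x].Sublist l := by
  obtain ⟨p, s, rfl⟩ := List.append_of_mem hx
  rcases List.mem_append.mp hy with h | h
  · exact Or.inr (pair_sublist_iff.mpr ⟨p, s, rfl, h⟩)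
  · rcases List.mem_cons.mp h with h | h
    · exact absurd h.symm hxy
    · exact Or.inl (((List.singleton_sublist.mpr h).cons_cons x).trans
        (List.sublist_append_right _ _))

/-- Transitivity of "arrives before". It needs distinct entries: otherwise the two pairs could use
different copies of `y`. -/
theorem triple_sublist_of_pairs {x y z : α} {l : List α} (hl : l.Nodup)
    (h1 : [x, y].Sublist l) (h2 : [y, z].Sublist l) : [x, y, z].Sublist l := by
  obtain ⟨p, s, rfl, hx⟩ := pair_sublist_iff.mp h1
  refine triple_sublist_iff.mpr ⟨p, s, rfl, hx, ?_⟩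
  obtain ⟨q, t, ht, hy⟩ := pair_sublist_iff.mp h2
  have hyp : y ∉ p := by
    intro h
    exact (List.disjoint_of_nodup_append hl) h (by simp)
  have hzs : z ∉ p ++ [y] := by
    intro hz
    have h3 : [z, y].Sublist (p ++ y :: s) ∨ z = y := by
      rcases List.mem_append.mp hz with h | h
      · exact Or.inl (pair_sublist_iff.mpr ⟨p, s, rfl, h⟩)
      · exact Or.inr (by simpa using h)
    have hnd : ∀ w, ¬ [w, w].Sublist (p ++ y :: s) := by
      intro w hw
      simpa using hl.sublist hw
    rcases h3 with h3 | rfl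
    · rw [ht] at h3 hl
      -- Both splittings are cut at the unique occurrence of `y`, so what precedes `y` in `h3` is an
      -- initial part of `q`. Then `z` occurs both in `q` and right after it.
      have h4 : z ∈ q := by
        obtain ⟨u, v, huv, hz'⟩ := pair_sublist_iff.mp h3
        have := hl
        rw [huv] at this
        obtain ⟨q₁, q₂, rfl⟩ := List.append_of_mem hy
        have hu : y ∉ u := fun h => List.disjoint_of_nodup_append this h (by simp)
        have hq : y ∉ q₁ := by
          intro h
          have : (q₁ ++ y :: q₂).Nodup := (List.nodup_append.mp hl).1
          exact List.disjoint_of_nodup_append this h (by simp)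
        have heq : u ++ y :: v = q₁ ++ y :: (q₂ ++ z :: t) := by rw [← huv]; simp
        rcases List.append_eq_append_iff.mp heq with ⟨w, hw1, hw2⟩ | ⟨w, hw1, hw2⟩
        · rcases w with _ | ⟨c, w⟩
          · simp at hw1; simp [hw1, hz']
          · simp at hw2; exact absurd (by simp [hw1, hw2.1]) hq
        · rcases w with _ | ⟨c, w⟩
          · simp at hw1; simp [← hw1, hz']
          · simp at hw2; exact absurd (by simp [hw1, hw2.1]) hu
      exact List.disjoint_of_nodup_append hl h4 (by simp)
    · exact hnd _ h2
  have hz : z ∈ p ++ y :: s := h2.subset (by simp)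
  simp at hz hzs
  tauto

theorem exists_last_split {l : List α} {P : α → Prop} (h : ∃ x ∈ l, P x) :
    ∃ p a s, l = p ++ a :: s ∧ P a ∧ ∀ v ∈ s, ¬ P v := by
  induction l using List.reverseRecOn with
  | nil => simp at h
  | append_singleton l a ih =>
    by_cases ha : P a
    · exact ⟨l, a, [], rfl, ha, by simp⟩
    · obtain ⟨x, hx, hP⟩ := h
      have hx' : x ∈ l := by
        rcases List.mem_append.mp hx with h | h
        · exact h
        · obtain rfl : x = a := by simpa using h
          exact absurd hP ha
      obtain ⟨p, b, s, rfl, hb, hs⟩ := ih ⟨x, hx', hP⟩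
      refine ⟨p, b, s ++ [a], by simp, hb, ?_⟩
      intro v hv
      rcases List.mem_append.mp hv with h | h
      · exact hs v h
      · obtain rfl : v = a := by simpa using h
        exact ha

end Sublists

theorem nodup_of_mem_permutations {n : ℕ} {τ : List (Fin n)} (h : τ ∈ permutations n) : τ.Nodup :=
  List.nodup_iff_count_le_one.mpr fun a => (h a).le

theorem mem_of_mem_permutations {n : ℕ} {τ : List (Fin n)} (h : τ ∈ permutations n) (a : Fin n) :
    a ∈ τ :=
  List.count_pos_iff.mp (by rw [h a]; exact one_pos)

/-! ### Blocks of values and counts of seen values -/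

section Blocks

variable {n : ℕ} (B : ℕ)

/-- The values seen in a prefix that lie in the `j`-th block of `B` consecutive values. -/
def blockSeen (l : List (Fin n)) (j : ℕ) : Finset (Fin n) :=
  l.toFinset.filter fun v => v.val / B = j

variable {B}

theorem mem_blockSeen {l : List (Fin n)} {j : ℕ} {v : Fin n} :
    v ∈ blockSeen B l j ↔ v ∈ l ∧ v.val / B = j := by
  simp [blockSeen]

theorem blockSeen_concat (l : List (Fin n)) (a : Fin n) (j : ℕ) :
    blockSeen B (l ++ [a]) j =
      if a.val / B = j then insert a (blockSeen B l j) else blockSeen B l j := by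
  ext v
  split_ifs with h <;> simp only [mem_blockSeen, Finset.mem_insert, List.mem_append,
    List.mem_singleton] <;> grind

theorem card_blockSeen_concat_congr {l l' : List (Fin n)} {a : Fin n} {j : ℕ}
    (hl : (l ++ [a]).Nodup) (hl' : (l' ++ [a]).Nodup)
    (h : (blockSeen B l j).card = (blockSeen B l' j).card) :
    (blockSeen B (l ++ [a]) j).card = (blockSeen B (l' ++ [a]) j).card := by
  have key : ∀ m : List (Fin n), (m ++ [a]).Nodup → a ∉ blockSeen B m j := by
    intro m hm ha
    exact List.disjoint_of_nodup_append hm (mem_blockSeen.mp ha).1 (by simp)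
  rw [blockSeen_concat, blockSeen_concat]
  split_ifs
  · rw [Finset.card_insert_of_notMem (key l hl), Finset.card_insert_of_notMem (key l' hl'), h]
  · exact h

/-- If `l'` had exhausted the block, what `l` saw of it would be a proper subset of what `l'` saw.
Thus the count alone tells whether a block still has an unseen value. -/
theorem exists_unseen_of_card_eq {l l' : List (Fin n)} {j : ℕ}
    (h : (blockSeen B l j).card = (blockSeen B l' j).card)
    (hv : ∃ v, v ∉ l ∧ v.val / B = j) : ∃ v, v ∉ l' ∧ v.val / B = j := by
  by_contra! hc
  obtain ⟨v, hv, hj⟩ := hv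
  have : blockSeen B l j ⊂ blockSeen B l' j := by
    refine ⟨fun w hw => ?_, fun hs => hv ?_⟩
    · rw [mem_blockSeen] at hw ⊢
      exact ⟨by_contra fun h => hc w h hw.2, hw.2⟩
    · exact (mem_blockSeen.mp (hs (mem_blockSeen.mpr ⟨by_contra fun h => hc v h hj, hj⟩))).1
  exact (Finset.card_lt_card this).ne h

theorem div_lt_blocks (v : Fin n) : v.val / B < n / B + 1 :=
  Nat.lt_succ_of_le (Nat.div_le_div_right v.isLt.le)

end Blocks

end StreamPPM

namespace StreamPPM

/-! ### The pattern 312 -/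

section Pattern312

variable {n : ℕ} (B : ℕ)

/-- One more than the largest value seen, and `0` at the start. -/
def seenTop (l : List (Fin n)) : ℕ :=
  l.toFinset.sup fun v => v.val + 1

/-- The block of the largest value seen. -/
def topBlock (l : List (Fin n)) : ℕ :=
  (seenTop l - 1) / B

/-- The values of block `j` that arrived after some value of a higher block. -/
noncomputable def late (l : List (Fin n)) (j : ℕ) : Finset (Fin n) := by
  classical
  exact Finset.univ.filter fun x => x.val / B = j ∧ ∃ z : Fin n, j < z.val / B ∧ [z, x].Sublist l

/-- The values seen in the block of the largest value seen, relative to the start of the block. -/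
noncomputable def topBlockSeen (l : List (Fin n)) : Finset (Fin B) := by
  classical
  exact Finset.univ.filter fun i => ∃ v ∈ l, v.val = topBlock B l * B + i.val

/-- Whether the arrival of `a` after `l` reveals an occurrence of 312: some unseen value lies
between `a` and the maximum, and is in another block than `a` or in the current one; or a smaller
value of the block of `a` came late. -/
def Violation312 (l : List (Fin n)) (a : Fin n) : Prop :=
  (∃ y : Fin n, y ∉ l ∧ a < y ∧ y.val + 1 < seenTop l ∧
      (y.val / B ≠ a.val / B ∨ a.val / B = topBlock B l)) ∨
    ∃ x ∈ late B l (a.val / B), x < a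

/-- The information about a prefix that is kept for recognizing 312. -/
noncomputable def summary312 (l : List (Fin n)) :
    (Fin (n / B + 1) → Fin (n + 1) × WithTop (Fin n)) × Fin (n + 1) × Finset (Fin B) :=
  (fun j => (⟨(blockSeen B l j).card, Nat.lt_succ_of_le (card_finset_fin_le _)⟩,
      (late B l j).min),
    ⟨seenTop l, Nat.lt_succ_of_le (Finset.sup_le fun v _ => v.isLt)⟩, topBlockSeen B l)

variable {B}

theorem lt_seenTop {l : List (Fin n)} {v : Fin n} (h : v ∈ l) : v.val + 1 ≤ seenTop l :=
  Finset.le_sup (f := fun v : Fin n => v.val + 1) (List.mem_toFinset.mpr h)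

theorem succ_lt_seenTop_iff {l : List (Fin n)} {y : Fin n} :
    y.val + 1 < seenTop l ↔ ∃ z ∈ l, y < z := by
  simp [seenTop, Finset.lt_sup_iff]

theorem seenTop_concat (l : List (Fin n)) (a : Fin n) :
    seenTop (l ++ [a]) = max (a.val + 1) (seenTop l) := by
  have : (l ++ [a]).toFinset = insert a l.toFinset := by ext; simp
  rw [seenTop, this, Finset.sup_insert]
  rfl

theorem topBlock_concat (l : List (Fin n)) (a : Fin n) :
    topBlock B (l ++ [a]) = max (a.val / B) (topBlock B l) := by
  rw [topBlock, topBlock, seenTop_concat]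
  rcases le_total (a.val + 1) (seenTop l) with h | h
  · rw [max_eq_right h, max_eq_right]
    exact Nat.div_le_div_right (by omega)
  · rw [max_eq_left h, max_eq_left]
    · simp
    · exact Nat.div_le_div_right (by omega)

theorem div_le_topBlock {l : List (Fin n)} {v : Fin n} (h : v ∈ l) : v.val / B ≤ topBlock B l :=
  Nat.div_le_div_right (by have := lt_seenTop h; omega)

/-- The empty prefix is no exception: truncated subtraction gives it top block 0, and nothing is
strictly below 0. -/
theorem lt_topBlock_iff {l : List (Fin n)} {j : ℕ} :
    j < topBlock B l ↔ ∃ v ∈ l, j < v.val / B := by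
  induction l using List.reverseRecOn with
  | nil => simp [topBlock, seenTop]
  | append_singleton l a ih =>
    rw [topBlock_concat, lt_max_iff, ih]
    simp [or_and_right, exists_or, or_comm]

theorem mem_late {l : List (Fin n)} {j : ℕ} {x : Fin n} :
    x ∈ late B l j ↔ x.val / B = j ∧ ∃ z : Fin n, j < z.val / B ∧ [z, x].Sublist l := by
  simp [late]

/-- Lateness is fixed at arrival: a new value is late exactly when its block lies below the current
top block. So the minimum late value can be updated without knowing the late set. -/
theorem late_concat (l : List (Fin n)) (a : Fin n) (j : ℕ) :
    late B (l ++ [a]) j =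
      if a.val / B = j ∧ j < topBlock B l then insert a (late B l j) else late B l j := by
  ext x
  simp only [lt_topBlock_iff]
  split_ifs with h <;> simp only [mem_late, Finset.mem_insert, pair_sublist_concat]
  · obtain ⟨h1, v, hv, hj⟩ := h
    constructor
    · rintro ⟨hx, z, hz, hs | ⟨rfl, _⟩⟩
      · exact Or.inr ⟨hx, z, hz, hs⟩
      · exact Or.inl rfl
    · rintro (rfl | ⟨hx, z, hz, hs⟩)
      · exact ⟨h1, v, hj, Or.inr ⟨rfl, hv⟩⟩
      · exact ⟨hx, z, hz, Or.inl hs⟩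
  · refine and_congr_right fun hx => exists_congr fun z => and_congr_right fun hz => ?_
    refine or_iff_left ?_
    rintro ⟨rfl, hzl⟩
    exact h ⟨hx, z, hzl, hz⟩

theorem mem_topBlockSeen {l : List (Fin n)} {i : Fin B} :
    i ∈ topBlockSeen B l ↔ ∃ v ∈ l, v.val = topBlock B l * B + i.val := by
  simp [topBlockSeen]

theorem topBlockSeen_eq_iff (hB : 0 < B) {l l' : List (Fin n)}
    (ht : topBlock B l = topBlock B l') :
    topBlockSeen B l = topBlockSeen B l' ↔
      ∀ v : Fin n, v.val / B = topBlock B l → (v ∈ l ↔ v ∈ l') := by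
  constructor
  · intro h v hv
    have key : ∀ m : List (Fin n), topBlock B m = topBlock B l →
        (v ∈ m ↔ (⟨v.val % B, Nat.mod_lt _ hB⟩ : Fin B) ∈ topBlockSeen B m) := by
      intro m hm
      have hval : v.val = topBlock B m * B + v.val % B := by
        rw [hm, ← hv, mul_comm]
        exact (Nat.div_add_mod _ _).symm
      rw [mem_topBlockSeen]
      constructor
      · intro hvm
        exact ⟨v, hvm, hval⟩
      · rintro ⟨w, hw, he⟩
        have : w = v := Fin.ext (by rw [he, ← hval])
        exact this ▸ hw
    rw [key l rfl, key l' ht.symm, h]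
  · intro h
    have hdiv : ∀ (i : Fin B) (v : Fin n), v.val = topBlock B l * B + i.val →
        v.val / B = topBlock B l := by
      intro i v hv
      rw [hv, mul_comm, Nat.mul_add_div hB, Nat.div_eq_of_lt i.isLt, add_zero]
    ext i
    rw [mem_topBlockSeen, mem_topBlockSeen, ← ht]
    exact exists_congr fun v => and_congr_left fun hv => h v (hdiv i v hv)

theorem summary312_eq_iff (hB : 0 < B) {l l' : List (Fin n)} :
    summary312 B l = summary312 B l' ↔
      (∀ j, j < n / B + 1 → (blockSeen B l j).card = (blockSeen B l' j).card) ∧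
      (∀ j, j < n / B + 1 → (late B l j).min = (late B l' j).min) ∧
      seenTop l = seenTop l' ∧ ∀ v : Fin n, v.val / B = topBlock B l → (v ∈ l ↔ v ∈ l') := by
  have : seenTop l = seenTop l' → topBlock B l = topBlock B l' := fun h => by
    rw [topBlock, h, topBlock]
  simp only [summary312, Prod.mk.injEq, funext_iff, Fin.mk.injEq, Fin.forall_iff, forall_and,
    and_assoc]
  refine and_congr_right fun _ => and_congr_right fun _ => and_congr_right fun h => ?_
  exact (topBlockSeen_eq_iff hB (this h)).trans (by simp only [Fin.forall_iff])

theorem summary312_concat (hB : 0 < B) {l l' : List (Fin n)} {a : Fin n}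
    (hl : (l ++ [a]).Nodup) (hl' : (l' ++ [a]).Nodup) (h : summary312 B l = summary312 B l') :
    summary312 B (l ++ [a]) = summary312 B (l' ++ [a]) := by
  rw [summary312_eq_iff hB] at h ⊢
  obtain ⟨h1, h2, h3, h4⟩ := h
  have ht : topBlock B l = topBlock B l' := by rw [topBlock, h3, topBlock]
  refine ⟨fun j hj => card_blockSeen_concat_congr hl hl' (h1 j hj), fun j hj => ?_, ?_, ?_⟩
  · rw [late_concat, late_concat, ht]
    split_ifs
    · rw [Finset.min_insert, Finset.min_insert, h2 j hj]
    · exact h2 j hj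
  · rw [seenTop_concat, seenTop_concat, h3]
  · intro v hv
    rw [topBlock_concat] at hv
    simp only [List.mem_append, List.mem_singleton]
    refine or_congr_left ?_
    rcases le_or_gt (a.val / B) (topBlock B l) with hle | hlt
    · rw [max_eq_right hle] at hv
      exact h4 v hv
    · rw [max_eq_left hlt.le] at hv
      -- A new maximum in a higher block replaces the top block by one of which nothing has been
      -- seen, so the stored set restarts from empty.
      have key : ∀ m : List (Fin n), topBlock B m < v.val / B → v ∉ m := fun m hm hvm =>
        (div_le_topBlock hvm).not_gt hm
      exact iff_of_false (key l (hv ▸ hlt)) (key l' (ht ▸ hv ▸ hlt))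

theorem violation312_congr (hB : 0 < B) {l l' : List (Fin n)} {a : Fin n}
    (h : summary312 B l = summary312 B l') (hv : Violation312 B l a) : Violation312 B l' a := by
  rw [summary312_eq_iff hB] at h
  obtain ⟨h1, h2, h3, h4⟩ := h
  have ht : topBlock B l = topBlock B l' := by rw [topBlock, h3, topBlock]
  rcases hv with ⟨y, hy, hay, hyt, hc⟩ | ⟨x, hx, hxa⟩
  · left
    have hle : y.val / B ≤ topBlock B l := Nat.div_le_div_right (by omega)
    rcases hle.eq_or_lt with he | hlt
    · exact ⟨y, fun hy' => hy ((h4 y he).2 hy'), hay, h3 ▸ hyt, ht ▸ hc⟩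
    · have hay' : a.val / B ≤ y.val / B := Nat.div_le_div_right (by exact hay.le)
      have hne : y.val / B ≠ a.val / B := by
        rcases hc with hc | hc
        · exact hc
        · omega
      obtain ⟨w, hw, hwy⟩ := exists_unseen_of_card_eq (h1 _ (div_lt_blocks y)) ⟨y, hy, rfl⟩
      refine ⟨w, hw, ?_, ?_, Or.inl (hwy ▸ hne)⟩
      · rw [Fin.lt_def]
        exact Nat.lt_of_div_lt_div (hwy ▸ lt_of_le_of_ne hay' hne.symm)
      · have : w.val < seenTop l - 1 := Nat.lt_of_div_lt_div (hwy ▸ hlt)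
        omega
  · right
    obtain ⟨m, hm⟩ := Finset.min_of_mem hx
    have hmx : m ≤ x := Finset.min_le_of_eq hx hm
    rw [h2 _ (div_lt_blocks a)] at hm
    exact ⟨m, Finset.mem_of_min hm, hmx.trans_lt hxa⟩

/-- The two clauses of `Violation312` report an occurrence at x or at y respectively. Conversely, an
unseen y must still arrive, and a late x already has a value of a higher block before it, which
exceeds every value of the block of x. -/
theorem contains_312_iff_violation {τ : List (Fin n)} (hτ : τ ∈ permutations n) :
    Contains τ [3, 1, 2] ↔ ∃ l a r, τ = l ++ a :: r ∧ Violation312 B l a := by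
  have hnd := nodup_of_mem_permutations hτ
  rw [contains_312]
  constructor
  · rintro ⟨z, x, y, hs, hxy, hyz⟩
    obtain ⟨p, s, rfl, hz, hy⟩ := triple_sublist_iff.mp hs
    have hyp : y ∉ p := fun h => List.disjoint_of_nodup_append hnd h (by simp [hy])
    by_cases hc : y.val / B ≠ x.val / B ∨ x.val / B = topBlock B p
    · exact ⟨p, x, s, rfl, Or.inl ⟨y, hyp, hxy, succ_lt_seenTop_iff.mpr ⟨z, hz, hyz⟩, hc⟩⟩
    · push Not at hc
      obtain ⟨hyx, hne⟩ := hc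
      have hxz : x.val / B ≤ topBlock B p :=
        (Nat.div_le_div_right (hxy.trans hyz).le).trans (div_le_topBlock hz)
      -- The original z may lie in the block of x and y; it is replaced by some `v` from a higher
      -- block.
      obtain ⟨v, hv, hxv⟩ := lt_topBlock_iff.mp (lt_of_le_of_ne hxz hne)
      obtain ⟨s₁, s₂, rfl⟩ := List.append_of_mem hy
      refine ⟨p ++ x :: s₁, y, s₂, by simp, Or.inr ⟨x, mem_late.mpr ⟨hyx.symm, v, hyx ▸ hxv, ?_⟩, hxy⟩⟩
      exact pair_sublist_iff.mpr ⟨p, s₁, rfl, hv⟩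
  · rintro ⟨l, a, r, rfl, ⟨y, hy, hay, hyt, -⟩ | ⟨x, hx, hxa⟩⟩
    · obtain ⟨z, hz, hyz⟩ := succ_lt_seenTop_iff.mp hyt
      refine ⟨z, a, y, triple_sublist_iff.mpr ⟨l, r, rfl, hz, ?_⟩, hay, hyz⟩
      have := mem_of_mem_permutations hτ y
      simp only [List.mem_append, List.mem_cons] at this
      rcases this with h | h | h
      · exact absurd h hy
      · exact absurd h hay.ne'
      · exact h
    · obtain ⟨-, z, hz, hs⟩ := mem_late.mp hx
      refine ⟨z, x, a, ?_, hxa, ?_⟩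
      · exact hs.append (by simp : [a].Sublist (a :: r))
      · rw [Fin.lt_def]
        exact Nat.lt_of_div_lt_div hz

theorem spaceComplexity_312_le (hB : 0 < B) :
    spaceComplexity (PPM [3, 1, 2] n) ≤
      (n / B + 1) * (2 * Nat.clog 2 (n + 1)) + Nat.clog 2 (n + 1) + B + 1 := by
  refine (spaceComplexity_le_of_summary (PPM [3, 1, 2] n) List.Nodup (summary312 B)
    (Violation312 B) ?_ (fun l l' a hl hl' h => summary312_concat hB hl hl' h)
    (fun l l' a _ _ h hv => violation312_congr hB h hv) ?_).trans ?_
  · intro τ hτ l hl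
    exact (nodup_of_mem_permutations hτ).sublist hl.sublist
  · intro τ hτ
    rw [← contains_312_iff_violation hτ]
    exact ⟨fun h => h.2, fun h => ⟨hτ, h⟩⟩
  · refine Nat.clog_le_of_le_pow ?_
    have hcard : Nat.card (WithTop (Fin n)) = n + 1 := by
      change Nat.card (Option (Fin n)) = n + 1
      simp
    have hL : n + 1 ≤ 2 ^ Nat.clog 2 (n + 1) := Nat.le_pow_clog one_lt_two _
    simp only [Nat.card_prod, Nat.card_fun, Nat.card_fin, hcard, Nat.card_eq_fintype_card (α := Finset (Fin B)), Fintype.card_finset, Fintype.card_fin]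
    calc _ ≤ ((2 ^ Nat.clog 2 (n + 1) * 2 ^ Nat.clog 2 (n + 1)) ^ (n / B + 1) *
            (2 ^ Nat.clog 2 (n + 1) * 2 ^ B)) * 2 := by gcongr
      _ = _ := by rw [← pow_add, ← pow_mul]; ring

end Pattern312

end StreamPPM

namespace StreamPPM

/-! ### The pattern 213 -/

section Pattern213

variable {n : ℕ} (B : ℕ)

/-- The highest block with an unseen value. -/
def openBlock (l : List (Fin n)) : ℕ :=
  (Finset.univ.filter fun v => v ∉ l).sup fun v => v.val / B

open Classical in
/-- The values of block `j` that arrived after all values of higher blocks, in order of arrival. -/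
noncomputable def afterHigher (l : List (Fin n)) (j : ℕ) : List (Fin n) :=
  l.filter fun x => decide (x.val / B = j ∧ ∀ v : Fin n, j < v.val / B → [v, x].Sublist l)

/-- Whether the arrival of `a` after `l` reveals an occurrence of 213: `a` is in a block below the
open block and there is a larger seen value below an unseen one; or `a` completes the open block
and within this block there is an occurrence whose last two entries came after all higher
blocks. -/
def Violation213 (l : List (Fin n)) (a : Fin n) : Prop :=
  (a.val / B < openBlock B l ∧ ∃ y ∈ l, ∃ z ∉ l, a < y ∧ y < z) ∨
    (a.val / B = openBlock B l ∧ (∀ v : Fin n, v.val / B = openBlock B l → v ∈ l ++ [a]) ∧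
      ∃ x y z, x < y ∧ y < z ∧ [x, z].Sublist (afterHigher B (l ++ [a]) (openBlock B l)) ∧
        ¬ [x, y].Sublist (afterHigher B (l ++ [a]) (openBlock B l)))

/-- The information about a prefix that is kept for recognizing 213. -/
noncomputable def summary213 (l : List (Fin n)) :
    (Fin (n / B + 1) → Fin (n + 1) × WithTop (Fin n) × WithBot (Fin n)) ×
      (Fin B → Option (Fin n)) :=
  (fun j => (⟨(blockSeen B l j).card, Nat.lt_succ_of_le (card_finset_fin_le _)⟩,
      (blockSeen B l j).min, (blockSeen B l j).max),
    fun i => (afterHigher B l (openBlock B l))[i.val]?)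

variable {B}

theorem div_le_openBlock {l : List (Fin n)} {v : Fin n} (h : v ∉ l) : v.val / B ≤ openBlock B l :=
  Finset.le_sup (f := fun v : Fin n => v.val / B) (by simpa using h)

theorem mem_of_openBlock_lt {l : List (Fin n)} {v : Fin n} (h : openBlock B l < v.val / B) :
    v ∈ l :=
  by_contra fun hv => (div_le_openBlock hv).not_gt h

theorem exists_unseen_openBlock {l : List (Fin n)} {a : Fin n} (h : a ∉ l) :
    ∃ v, v ∉ l ∧ v.val / B = openBlock B l := by
  obtain ⟨v, hv, he⟩ := Finset.exists_mem_eq_sup (Finset.univ.filter fun v => v ∉ l)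
    ⟨a, by simpa using h⟩ fun v : Fin n => v.val / B
  exact ⟨v, by simpa using hv, he.symm⟩

theorem openBlock_congr {l l' : List (Fin n)}
    (h : ∀ j, j < n / B + 1 → (blockSeen B l j).card = (blockSeen B l' j).card) :
    openBlock B l = openBlock B l' := by
  have key : ∀ m m' : List (Fin n),
      (∀ j, j < n / B + 1 → (blockSeen B m j).card = (blockSeen B m' j).card) →
      openBlock B m ≤ openBlock B m' := by
    intro m m' hm
    refine Finset.sup_le fun v hv => ?_
    obtain ⟨w, hw, hwv⟩ := exists_unseen_of_card_eq (hm _ (div_lt_blocks v))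
      ⟨v, by simpa using hv, rfl⟩
    rw [← hwv]
    exact div_le_openBlock hw
  exact le_antisymm (key l l' h) (key l' l fun j hj => (h j hj).symm)

theorem openBlock_concat_le (l : List (Fin n)) (a : Fin n) :
    openBlock B (l ++ [a]) ≤ openBlock B l :=
  Finset.sup_mono fun v hv => by simp at hv ⊢; tauto

/-- The new letter cannot precede an older one, so membership of older entries does not change. The
letter itself is appended when its block is `j` and all higher blocks are already complete. -/
theorem afterHigher_concat {l : List (Fin n)} {a : Fin n} (hl : (l ++ [a]).Nodup) (j : ℕ)
    [Decidable (a.val / B = j ∧ ∀ v : Fin n, j < v.val / B → v ∈ l)] :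
    afterHigher B (l ++ [a]) j = afterHigher B l j ++
      if a.val / B = j ∧ ∀ v : Fin n, j < v.val / B → v ∈ l then [a] else [] := by
  classical
  have ha : a ∉ l := fun h => List.disjoint_of_nodup_append hl h (by simp)
  rw [afterHigher, List.filter_append, afterHigher]
  congr 1
  · refine List.filter_congr fun x hx => ?_
    have hxa : x ≠ a := fun h => ha (h ▸ hx)
    simp [pair_sublist_concat, hxa]
  · have hs : ∀ v, ¬ [v, a].Sublist l := fun v h => ha (h.subset (by simp))
    simp [List.filter_cons, pair_sublist_concat, hs]

theorem afterHigher_eq_nil {l : List (Fin n)} {j : ℕ} {v : Fin n} (hv : v ∉ l)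
    (hj : j < v.val / B) : afterHigher B l j = [] := by
  rw [afterHigher, List.filter_eq_nil_iff]
  intro x _ h
  exact hv ((of_decide_eq_true h).2 v hj |>.subset (by simp))

theorem afterHigher_concat_openBlock {l : List (Fin n)} {a : Fin n} (hl : (l ++ [a]).Nodup) :
    afterHigher B (l ++ [a]) (openBlock B l) = afterHigher B l (openBlock B l) ++
      if a.val / B = openBlock B l then [a] else [] := by
  classical
  rw [afterHigher_concat hl]
  congr 2
  simp only [eq_iff_iff, and_iff_left_iff_imp]
  exact fun _ v => mem_of_openBlock_lt

theorem length_afterHigher_le (hB : 0 < B) {l : List (Fin n)} (hl : l.Nodup) (j : ℕ) :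
    (afterHigher B l j).length ≤ B := by
  rw [← List.toFinset_card_of_nodup (show (afterHigher B l j).Nodup from hl.filter _),
    ← Finset.card_range B]
  refine Finset.card_le_card_of_injOn (fun v : Fin n => v.val % B)
    (fun v _ => by simpa using Nat.mod_lt _ hB) ?_
  have key : ∀ v ∈ afterHigher B l j, v.val / B = j := fun v hv =>
    (of_decide_eq_true (List.mem_filter.mp hv).2).1
  intro v hv w hw h
  have h1 := key v (by simpa [afterHigher] using hv)
  have h2 := key w (by simpa [afterHigher] using hw)
  refine Fin.ext ?_
  rw [← Nat.div_add_mod v.val B, ← Nat.div_add_mod w.val B, h1, h2]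
  simpa using h

/-- The function on `Fin B` with values in `Option (Fin n)` determines the list, because the list
has length at most `B` and every further lookup is `none`. -/
theorem summary213_eq_iff (hB : 0 < B) {l l' : List (Fin n)} (hl : l.Nodup) (hl' : l'.Nodup) :
    summary213 B l = summary213 B l' ↔
      (∀ j, j < n / B + 1 → (blockSeen B l j).card = (blockSeen B l' j).card) ∧
      (∀ j, j < n / B + 1 → (blockSeen B l j).min = (blockSeen B l' j).min) ∧
      (∀ j, j < n / B + 1 → (blockSeen B l j).max = (blockSeen B l' j).max) ∧
      afterHigher B l (openBlock B l) = afterHigher B l' (openBlock B l') := by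
  simp only [summary213, Prod.mk.injEq, funext_iff, Fin.mk.injEq, Fin.forall_iff, forall_and,
    and_assoc]
  refine and_congr_right fun _ => and_congr_right fun _ => and_congr_right fun _ => ?_
  refine ⟨fun h => List.ext_getElem? fun i => ?_, fun h i _ => by rw [h]⟩
  by_cases hi : i < B
  · exact h i hi
  · rw [List.getElem?_eq_none, List.getElem?_eq_none]
    · exact (length_afterHigher_le hB hl' _).trans (not_lt.mp hi)
    · exact (length_afterHigher_le hB hl _).trans (not_lt.mp hi)

theorem summary213_concat (hB : 0 < B) {l l' : List (Fin n)} {a : Fin n}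
    (hl : (l ++ [a]).Nodup) (hl' : (l' ++ [a]).Nodup) (h : summary213 B l = summary213 B l') :
    summary213 B (l ++ [a]) = summary213 B (l' ++ [a]) := by
  rw [summary213_eq_iff hB (List.nodup_append.mp hl).1 (List.nodup_append.mp hl').1] at h
  rw [summary213_eq_iff hB hl hl']
  obtain ⟨h1, h2, h3, h4⟩ := h
  have hC := openBlock_congr h1
  have h1' := fun j hj => card_blockSeen_concat_congr hl hl' (h1 j hj)
  have hC' := openBlock_congr h1'
  refine ⟨h1', fun j hj => ?_, fun j hj => ?_, ?_⟩
  · rw [blockSeen_concat, blockSeen_concat]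
    split_ifs
    · rw [Finset.min_insert, Finset.min_insert, h2 j hj]
    · exact h2 j hj
  · rw [blockSeen_concat, blockSeen_concat]
    split_ifs
    · rw [Finset.max_insert, Finset.max_insert, h3 j hj]
    · exact h3 j hj
  · rcases (openBlock_concat_le (B := B) l a).eq_or_lt with he | hlt
    · rw [← hC', he, afterHigher_concat_openBlock hl, h4, hC, afterHigher_concat_openBlock hl']
    · have key : ∀ m : List (Fin n), (m ++ [a]).Nodup →
          openBlock B (m ++ [a]) < openBlock B m →
          afterHigher B (m ++ [a]) (openBlock B (m ++ [a])) = [] := by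
        classical
        intro m hm hlt
        have ha : a ∉ m := fun h => List.disjoint_of_nodup_append hm h (by simp)
        obtain ⟨v, hv, hvC⟩ := exists_unseen_openBlock (B := B) ha
        rw [afterHigher_concat hm, afterHigher_eq_nil hv (hvC ▸ hlt), if_neg, List.append_nil]
        exact fun h => hv (h.2 v (hvC ▸ hlt))
      rw [key l hl hlt, key l' hl' (by rwa [← hC', ← hC])]

theorem violation213_congr (hB : 0 < B) {l l' : List (Fin n)} {a : Fin n}
    (hl : (l ++ [a]).Nodup) (hl' : (l' ++ [a]).Nodup)
    (h : summary213 B l = summary213 B l') (hv : Violation213 B l a) : Violation213 B l' a := by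
  rw [summary213_eq_iff hB (List.nodup_append.mp hl).1 (List.nodup_append.mp hl').1] at h
  obtain ⟨h1, h2, h3, h4⟩ := h
  have hC := openBlock_congr h1
  have ha' : a ∉ l' := fun h => List.disjoint_of_nodup_append hl' h (by simp)
  rcases hv with ⟨haC, y, hy, z, hz, hay, hyz⟩ | ⟨haC, hfull, hx⟩
  · left
    refine ⟨hC ▸ haC, ?_⟩
    obtain ⟨w, hw, hwC⟩ := exists_unseen_openBlock (B := B) ha'
    have hayB : a.val / B ≤ y.val / B := Nat.div_le_div_right (by exact hay.le)
    have hyzB : y.val / B ≤ z.val / B := Nat.div_le_div_right (by exact hyz.le)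
    have hzC : z.val / B ≤ openBlock B l := div_le_openBlock hz
    have hyS : y ∈ blockSeen B l (y.val / B) := mem_blockSeen.mpr ⟨hy, rfl⟩
    rcases (hyzB.trans hzC).eq_or_lt with he | hlt
    · obtain ⟨m, hm⟩ := Finset.min_of_mem hyS
      have hmy : m ≤ y := Finset.min_le_of_eq hyS hm
      rw [h2 _ (div_lt_blocks y)] at hm
      obtain ⟨hml, hmB⟩ := mem_blockSeen.mp (Finset.mem_of_min hm)
      have ham : a < m := by
        rw [Fin.lt_def]
        exact Nat.lt_of_div_lt_div (by rw [hmB, he]; exact haC)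
      have hzy : z.val / B = y.val / B := by omega
      by_contra! hc
      -- Here y and z lie in the open block, and `m` is the common minimum of the seen values there.
      -- If `l'` had no unseen value above `m`, it would have seen everything from `m` upwards in
      -- this block, hence strictly more than `l`, contradicting equal counts.
      have hsub : blockSeen B l (y.val / B) ⊂ blockSeen B l' (y.val / B) := by
        have hmin : ∀ u ∈ blockSeen B l (y.val / B), m ≤ u := fun u hu =>
          Finset.min_le_of_eq hu (by rw [h2 _ (div_lt_blocks y), hm])
        have hmem : ∀ u : Fin n, m ≤ u → u.val / B = y.val / B →
            u ∈ blockSeen B l' (y.val / B) := by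
          intro u hu huB
          refine mem_blockSeen.mpr ⟨by_contra fun hul => ?_, huB⟩
          rcases hu.eq_or_lt with rfl | hlt
          · exact hul hml
          · exact (hc m hml u hul ham).not_gt hlt
        refine ⟨fun u hu => hmem u (hmin u hu) (mem_blockSeen.mp hu).2, fun hs => hz ?_⟩
        exact (mem_blockSeen.mp (hs (hmem z (hmy.trans hyz.le) hzy))).1
      exact (Finset.card_lt_card hsub).ne (h1 _ (div_lt_blocks y))
    -- Now y lies below the open block: the largest seen value of its block serves as y, and any
    -- unseen value of the open block as z.
    · obtain ⟨m, hm⟩ := Finset.max_of_mem hyS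
      have hmy : y ≤ m := Finset.le_max_of_eq hyS hm
      rw [h3 _ (div_lt_blocks y)] at hm
      obtain ⟨hml, hmB⟩ := mem_blockSeen.mp (Finset.mem_of_max hm)
      refine ⟨m, hml, w, hw, hay.trans_le hmy, ?_⟩
      rw [Fin.lt_def]
      exact Nat.lt_of_div_lt_div (by rw [hmB, hwC, ← hC]; exact hlt)
  · right
    have hseq : afterHigher B (l ++ [a]) (openBlock B l) =
        afterHigher B (l' ++ [a]) (openBlock B l') := by
      rw [afterHigher_concat_openBlock hl, afterHigher_concat_openBlock hl', h4, hC]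
    rw [hseq] at hx
    refine ⟨hC ▸ haC, fun v hv => by_contra fun hvl => ?_, hx⟩
    obtain ⟨w, hw, hwv⟩ := exists_unseen_of_card_eq
      (card_blockSeen_concat_congr hl hl' (h1 _ (div_lt_blocks v))).symm ⟨v, hvl, rfl⟩
    exact hw (hfull w (by rw [hwv, hv, hC]))

open Classical in
theorem pair_sublist_afterHigher {l : List (Fin n)} {j : ℕ} {x y : Fin n}
    (hx : x.val / B = j ∧ ∀ v : Fin n, j < v.val / B → [v, x].Sublist l)
    (hy : y.val / B = j ∧ ∀ v : Fin n, j < v.val / B → [v, y].Sublist l)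
    (h : [x, y].Sublist l) : [x, y].Sublist (afterHigher B l j) := by
  have := h.filter fun x : Fin n =>
    decide (x.val / B = j ∧ ∀ v : Fin n, j < v.val / B → [v, x].Sublist l)
  rwa [List.filter_cons_of_pos (by simpa using hx), List.filter_cons_of_pos (by simpa using hy),
    List.filter_nil] at this

theorem mem_afterHigher {l : List (Fin n)} {j : ℕ} {x : Fin n} (h : x ∈ afterHigher B l j) :
    x.val / B = j ∧ ∀ v : Fin n, j < v.val / B → [v, x].Sublist l :=
  of_decide_eq_true (List.mem_filter.mp h).2

/-- An occurrence inside the open block is reported only on completion of the block. By then y has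
been seen, so the absence of y after x in the list forces y before x, even if y came too early to be
in the list. -/
theorem contains_213_iff_violation {τ : List (Fin n)} (hτ : τ ∈ permutations n) :
    Contains τ [2, 1, 3] ↔ ∃ l a r, τ = l ++ a :: r ∧ Violation213 B l a := by
  have hnd := nodup_of_mem_permutations hτ
  rw [contains_213]
  constructor
  · rintro ⟨y, x, z, hs, hxy, hyz⟩
    obtain ⟨p, s, rfl, hy, hz⟩ := triple_sublist_iff.mp hs
    have hzp : z ∉ p := fun h => List.disjoint_of_nodup_append hnd h (by simp [hz])
    have hxp : x ∉ p := fun h => List.disjoint_of_nodup_append hnd h (by simp)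
    rcases (div_le_openBlock (B := B) hxp).lt_or_eq with hlt | he
    · exact ⟨p, x, s, rfl, Or.inl ⟨hlt, y, hy, z, hzp, hxy, hyz⟩⟩
    have hxyB : x.val / B ≤ y.val / B := Nat.div_le_div_right (by exact hxy.le)
    have hyzB : y.val / B ≤ z.val / B := Nat.div_le_div_right (by exact hyz.le)
    have hzC : z.val / B ≤ openBlock B p := div_le_openBlock hzp
    have hzB : z.val / B = openBlock B p := by omega
    -- The letter `a` is the last arrival in the block of x, y and z, so it completes the block.
    obtain ⟨s₁, a, s₂, rfl, haB, hlast⟩ :=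
      exists_last_split (P := fun v : Fin n => v.val / B = openBlock B p) ⟨z, hz, hzB⟩
    set l := p ++ x :: s₁ with hl
    have hτl : p ++ x :: (s₁ ++ a :: s₂) = l ++ a :: s₂ := by simp [hl]
    rw [hτl] at hnd hτ hs ⊢
    have hal : a ∉ l := fun h => List.disjoint_of_nodup_append hnd h (by simp)
    have hC : openBlock B l = openBlock B p := by
      refine le_antisymm (Finset.sup_mono fun v hv => ?_) (haB ▸ div_le_openBlock hal)
      simp [hl] at hv ⊢
      tauto
    have hafter : ∀ u : Fin n, u ∈ x :: (s₁ ++ [a]) →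
        ∀ v : Fin n, openBlock B p < v.val / B → [v, u].Sublist (l ++ [a]) := by
      intro u hu v hv
      have : l ++ [a] = p ++ x :: (s₁ ++ [a]) := by simp [hl]
      rw [this]
      exact (List.singleton_sublist.mpr (mem_of_openBlock_lt hv)).append
        (List.singleton_sublist.mpr hu)
    have hzs : z ∈ s₁ ++ [a] := by
      have : z ∉ s₂ := fun h => hlast z h hzB
      simp at hz ⊢
      tauto
    refine ⟨l, a, s₂, rfl, Or.inr ⟨haB.trans hC.symm, fun v hv => ?_, x, y, z, hxy, hyz, ?_, ?_⟩⟩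
    · have hvτ := mem_of_mem_permutations hτ v
      have : v ∉ s₂ := fun h => hlast v h (hv.trans hC)
      simp only [List.mem_append, List.mem_cons] at hvτ ⊢
      tauto
    · rw [hC]
      refine pair_sublist_afterHigher ⟨he, hafter x (by simp)⟩
        ⟨hzB, hafter z (List.mem_cons_of_mem _ hzs)⟩ ?_
      have : l ++ [a] = p ++ x :: (s₁ ++ [a]) := by simp [hl]
      rw [this]
      exact ((List.singleton_sublist.mpr hzs).cons_cons x).trans (List.sublist_append_right _ _)
    · intro h
      have h1 : [x, y].Sublist (l ++ a :: s₂) := by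
        have : [x, y].Sublist (l ++ [a]) := h.trans List.filter_sublist
        exact this.trans ((List.Sublist.refl l).append (by simp))
      have h2 : [y, x].Sublist (l ++ a :: s₂) := (by simp : [y, x].Sublist [y, x, z]).trans hs
      have := hnd.sublist (triple_sublist_of_pairs hnd h1 h2)
      simp at this
  · rintro ⟨l, a, r, rfl, ⟨-, y, hy, z, hz, hay, hyz⟩ | ⟨haC, hfull, x, y, z, hxy, hyz, hxz, hnot⟩⟩
    · refine ⟨y, a, z, triple_sublist_iff.mpr ⟨l, r, rfl, hy, ?_⟩, hay, hyz⟩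
      have := mem_of_mem_permutations hτ z
      simp only [List.mem_append, List.mem_cons] at this
      rcases this with h | h | h
      · exact absurd h hz
      · exact absurd h (hay.trans hyz).ne'
      · exact h
    · have hla : (l ++ [a]).Sublist (l ++ a :: r) := (List.Sublist.refl l).append (by simp)
      have hnd' := hnd.sublist hla
      have hx := mem_afterHigher (hxz.subset (by simp : x ∈ [x, z]))
      have hz := mem_afterHigher (hxz.subset (by simp : z ∈ [x, z]))
      have hxz' : [x, z].Sublist (l ++ [a]) := hxz.trans List.filter_sublist
      have hxyB : x.val / B ≤ y.val / B := Nat.div_le_div_right (by exact hxy.le)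
      have hyzB : y.val / B ≤ z.val / B := Nat.div_le_div_right (by exact hyz.le)
      have hyB : y.val / B = openBlock B l := by omega
      rcases pair_sublist_or (hxz'.subset (by simp)) (hfull y hyB) hxy.ne with h | h
      -- If y came after x, it too would come after all higher blocks and appear in the list behind
      -- x.
      · refine absurd (pair_sublist_afterHigher hx ⟨hyB, fun v hv => ?_⟩ h) hnot
        exact (by simp : [v, y].Sublist [v, x, y]).trans
          (triple_sublist_of_pairs hnd' (hx.2 v hv) h)
      · exact ⟨y, x, z, (triple_sublist_of_pairs hnd' h hxz').trans hla, hxy, hyz⟩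

theorem spaceComplexity_213_le (hB : 0 < B) :
    spaceComplexity (PPM [2, 1, 3] n) ≤
      (n / B + 1) * (3 * Nat.clog 2 (n + 1)) + B * Nat.clog 2 (n + 1) + 1 := by
  refine (spaceComplexity_le_of_summary (PPM [2, 1, 3] n) List.Nodup (summary213 B)
    (Violation213 B) ?_ (fun l l' a hl hl' h => summary213_concat hB hl hl' h)
    (fun l l' a hl hl' h hv => violation213_congr hB hl hl' h hv) ?_).trans ?_
  · intro τ hτ l hl
    exact (nodup_of_mem_permutations hτ).sublist hl.sublist
  · intro τ hτ
    rw [← contains_213_iff_violation hτ]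
    exact ⟨fun h => h.2, fun h => ⟨hτ, h⟩⟩
  · refine Nat.clog_le_of_le_pow ?_
    have hcard : Nat.card (Option (Fin n)) = n + 1 := by simp
    have hcard₁ : Nat.card (WithTop (Fin n)) = n + 1 := hcard
    have hcard₂ : Nat.card (WithBot (Fin n)) = n + 1 := hcard
    have hL : n + 1 ≤ 2 ^ Nat.clog 2 (n + 1) := Nat.le_pow_clog one_lt_two _
    simp only [Nat.card_prod, Nat.card_fun, Nat.card_fin, hcard, hcard₁, hcard₂]
    calc _ ≤ ((2 ^ Nat.clog 2 (n + 1) * (2 ^ Nat.clog 2 (n + 1) * 2 ^ Nat.clog 2 (n + 1))) ^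
            (n / B + 1) * (2 ^ Nat.clog 2 (n + 1)) ^ B) * 2 := by gcongr
      _ = _ := by simp only [← pow_add, ← pow_mul]; ring

end Pattern213

end StreamPPM

namespace StreamPPM

/-! ### Choice of block size and asymptotics -/

theorem one_le_log_of_three_le {n : ℕ} (hn : 3 ≤ n) : 1 ≤ Real.log n := by
  rw [Real.le_log_iff_exp_le (by positivity)]
  have : (3 : ℝ) ≤ n := by exact_mod_cast hn
  linarith [Real.exp_one_lt_d9]

theorem clog_succ_le {n : ℕ} (hn : 3 ≤ n) : (Nat.clog 2 (n + 1) : ℝ) ≤ 5 * Real.log n := by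
  have h3 : (3 : ℝ) ≤ n := by exact_mod_cast hn
  have h1 : 2 ^ (Nat.clog 2 (n + 1)).pred < n + 1 :=
    Nat.pow_pred_clog_lt_self one_lt_two (by omega)
  have hpos : 0 < Nat.clog 2 (n + 1) := Nat.clog_pos one_lt_two (by omega)
  obtain ⟨k, hk⟩ := Nat.exists_eq_add_of_lt hpos
  rw [zero_add] at hk
  rw [hk, Nat.pred_succ] at h1
  -- Comparing with n² absorbs the `+ 1`. Then k log 2 ≤ 2 log n, and k + 1 ≤ 5 log n follows from
  -- log 2 > 0.69 and log n ≥ 1.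
  have h2 : (2 : ℝ) ^ k ≤ (n : ℝ) ^ 2 := by
    have : (2 : ℝ) ^ k < n + 1 := by exact_mod_cast h1
    nlinarith
  have h4 := Real.log_le_log (by positivity) h2
  rw [Real.log_pow, Real.log_pow] at h4
  have h5 := one_le_log_of_three_le hn
  rw [hk]
  push_cast at h4 ⊢
  have h6 := Real.log_two_gt_d9
  have hk0 : (0 : ℝ) ≤ k := Nat.cast_nonneg k
  nlinarith

theorem spaceComplexity_312_isBigO :
    (fun n : ℕ => (spaceComplexity (PPM [3, 1, 2] n) : ℝ)) =O[Filter.atTop]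
      (fun n : ℕ => Real.sqrt ((n : ℝ) * Real.log (n : ℝ))) := by
  -- With B = ⌈s⌉ the constant is 20 + 5 + 2 + 1, for the blocks, the maximum, the set in the top
  -- block and the final bit.
  refine Asymptotics.IsBigO.of_bound 28 ?_
  filter_upwards [Filter.eventually_ge_atTop 3] with n hn
  rw [Real.norm_of_nonneg (Nat.cast_nonneg _), Real.norm_of_nonneg (Real.sqrt_nonneg _)]
  set s := Real.sqrt ((n : ℝ) * Real.log n) with hs
  have h3 : (3 : ℝ) ≤ n := by exact_mod_cast hn
  have hlog := one_le_log_of_three_le hn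
  have hsq : s * s = n * Real.log n := Real.mul_self_sqrt (by positivity)
  have hlogs : Real.log n ≤ s := by
    refine Real.le_sqrt_of_sq_le ?_
    nlinarith [Real.log_le_self (x := n) (by positivity)]
  have hs1 : 1 ≤ s := hlog.trans hlogs
  have hB : 0 < ⌈s⌉₊ := Nat.ceil_pos.mpr (by linarith)
  have hBs : (⌈s⌉₊ : ℝ) ≤ 2 * s := by linarith [Nat.ceil_lt_add_one (a := s) (by linarith)]
  have hdiv : ((n / ⌈s⌉₊ : ℕ) : ℝ) ≤ n / s :=
    Nat.cast_div_le.trans (div_le_div_of_nonneg_left (by positivity) (by linarith) (Nat.le_ceil s))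
  have hmul : ((n / ⌈s⌉₊ : ℕ) : ℝ) * Real.log n ≤ s := by
    refine (mul_le_mul_of_nonneg_right hdiv (by linarith)).trans_eq ?_
    rw [div_mul_eq_mul_div, ← hsq, mul_self_div_self]
  have hL := clog_succ_le hn
  have hb : (spaceComplexity (PPM [3, 1, 2] n) : ℝ) ≤ _ :=
    Nat.cast_le.mpr (spaceComplexity_312_le (n := n) hB)
  push_cast at hb
  have : ((n / ⌈s⌉₊ : ℕ) + 1 : ℝ) * (2 * Nat.clog 2 (n + 1)) ≤
      ((n / ⌈s⌉₊ : ℕ) + 1 : ℝ) * (2 * (5 * Real.log n)) := by gcongr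
  linarith

theorem spaceComplexity_213_isBigO :
    (fun n : ℕ => (spaceComplexity (PPM [2, 1, 3] n) : ℝ)) =O[Filter.atTop]
      (fun n : ℕ => Real.sqrt (n : ℝ) * Real.log (n : ℝ)) := by
  -- With B = ⌈√n⌉ the constant is 30 + 10 + 1, for the blocks, the list and the final bit.
  refine Asymptotics.IsBigO.of_bound 41 ?_
  filter_upwards [Filter.eventually_ge_atTop 3] with n hn
  have hlog := one_le_log_of_three_le hn
  rw [Real.norm_of_nonneg (Nat.cast_nonneg _),
    Real.norm_of_nonneg (mul_nonneg (Real.sqrt_nonneg _) (by linarith))]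
  set s := Real.sqrt (n : ℝ) with hs
  have h3 : (3 : ℝ) ≤ n := by exact_mod_cast hn
  have hsq : s * s = n := Real.mul_self_sqrt (by positivity)
  have hs1 : 1 ≤ s := Real.one_le_sqrt.mpr (by linarith)
  have hB : 0 < ⌈s⌉₊ := Nat.ceil_pos.mpr (by linarith)
  have hBs : (⌈s⌉₊ : ℝ) ≤ 2 * s := by linarith [Nat.ceil_lt_add_one (a := s) (by linarith)]
  have hdiv : ((n / ⌈s⌉₊ : ℕ) : ℝ) ≤ s := by
    refine Nat.cast_div_le.trans ((div_le_div_of_nonneg_left (by positivity) (by linarith)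
      (Nat.le_ceil s)).trans_eq ?_)
    rw [← hsq, mul_self_div_self]
  have hL := clog_succ_le hn
  have hb : (spaceComplexity (PPM [2, 1, 3] n) : ℝ) ≤ _ :=
    Nat.cast_le.mpr (spaceComplexity_213_le (n := n) hB)
  push_cast at hb
  have h1 : ((n / ⌈s⌉₊ : ℕ) + 1 : ℝ) * (3 * Nat.clog 2 (n + 1)) ≤
      (s + s) * (3 * (5 * Real.log n)) := by gcongr
  have h2 : (⌈s⌉₊ : ℝ) * Nat.clog 2 (n + 1) ≤ 2 * s * (5 * Real.log n) := by gcongr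
  nlinarith

end StreamPPM

theorem theoremp :
    (∀ π : List ℕ, π = [3, 1, 2] ∨ π = [1, 3, 2] →
      (fun n : ℕ => (StreamPPM.spaceComplexity (StreamPPM.PPM π n) : ℝ)) =O[Filter.atTop]
        (fun n : ℕ => Real.sqrt ((n : ℝ) * Real.log (n : ℝ)))) ∧
    (∀ π : List ℕ, π = [2, 3, 1] ∨ π = [2, 1, 3] →
      (fun n : ℕ => (StreamPPM.spaceComplexity (StreamPPM.PPM π n) : ℝ)) =O[Filter.atTop]
        (fun n : ℕ => Real.sqrt (n : ℝ) * Real.log (n : ℝ))) := by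
  refine ⟨?_, ?_⟩
  · rintro π (rfl | rfl)
    · exact StreamPPM.spaceComplexity_312_isBigO
    · refine (Asymptotics.IsBigO.of_norm_le fun n => ?_).trans
        StreamPPM.spaceComplexity_312_isBigO
      simpa using StreamPPM.spaceComplexity_le_of_map_rev (n := n) StreamPPM.contains_312_map_rev
  · rintro π (rfl | rfl)
    · refine (Asymptotics.IsBigO.of_norm_le fun n => ?_).trans
        StreamPPM.spaceComplexity_213_isBigO
      simpa using StreamPPM.spaceComplexity_le_of_map_rev (n := n) StreamPPM.contains_213_map_rev
    · exact StreamPPM.spaceComplexity_213_isBigO
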